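/- Let $A$ be a $C^*$-algebra of compact operators, i.e. (up to isomorphism) a $C^*$-subalgebra of the algebra $K(H)$ of compact operators on some (not necessarily separable) complex Hilbert space $H$. Let $U$ and $V$ be (right) Hilbert $A$-modules with $A$-valued products $(\cdot,\cdot)$, conjugate linear in the first variable, and let $F\colon U\to V$ be a morphism, i.e. a continuous, $A$-linear and adjointable map. Then $F$ is $A$-Fredholm if and only if its image $\operatorname{Im}F$ is closed and both $\dim_A \operatorname{Ker}F$ and $\dim_A(\operatorname{Im}F)^{\perp}$ are finite. Here $F$ is called $A$-Fredholm if there are morphisms $G_U, G_V\colon V\to U$ and $A$-compact operators $P_U\colon U\to U$, $P_V\colon V\to V$ with $G_UF=1_U+P_U$ and $FG_V=1_V+P_V$. An operator between Hilbert $A$-modules $X$ and $Y$ is $A$-compact if it lies in the operator-norm closure, inside the space of morphisms $X \to Y$, of the linear span of the elementary operators $x'\mapsto y\cdot(x,x')$ with $x\in X$, $y\in Y$. The complement is $(\operatorname{Im}F)^{\perp}=\{v\in V : (v,w)=0 \text{ for all } w\in \operatorname{Im}F\}$. For a Hilbert $A$-module $W$, $\dim_A W$ is the cardinality of an orthonormal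 basis of $W$, that is, of a set of pairwise orthogonal elements $w\in W$ for each of which $e=(w,w)$ is a minimal projection of $A$ (a nonzero projection with $eAe=\mathbb{C}e$), and which generates a norm-dense $A$-submodule of $W$. Over a $C^*$-algebra of compact operators, this cardinality does not depend on the basis. -/

import Mathlib

open scoped RightActions

universe w

/-!
Right Hilbert modules over a C*-algebra `A` are Mathlib's `CStarModule`s over the opposite algebra
`Aᵐᵒᵖ`: the right action of `a` is `u <• a = MulOpposite.op a • u`, and
`CStarModule.inner_op_smul_right` says `(u, v · a) = (u, v) a`.  A Hilbert module is one which is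
complete for its norm.
-/

namespace HilbertCStar

section General

variable (A : Type*) [NonUnitalCStarAlgebra A] [PartialOrder A] [StarOrderedRing A]

/-- `A` is a C*-algebra of compact operators: it is (isomorphic to) a C*-subalgebra of the compact
operators on some complex Hilbert space.  (An injective `*`-homomorphism of C*-algebras is isometric
and has closed image.) -/
def IsAlgebraOfCompactOperators : Prop :=
  ∃ (H : Type w) (_ : NormedAddCommGroup H) (_ : InnerProductSpace ℂ H) (_ : CompleteSpace H)
    (φ : A →⋆ₙₐ[ℂ] (H →L[ℂ] H)), Function.Injective φ ∧ ∀ a : A, IsCompactOperator (φ a)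

variable {A} in
/-- A minimal projection of `A`: a nonzero projection `e` with `e A e = ℂ e`. -/
def IsMinimalProjection (e : A) : Prop :=
  IsStarProjection e ∧ e ≠ 0 ∧ ∀ a : A, ∃ z : ℂ, e * a * e = z • e

section Modules

variable {U V : Type*}
  [NormedAddCommGroup U] [NormedSpace ℂ U] [SMul Aᵐᵒᵖ U] [CStarModule Aᵐᵒᵖ U]
  [NormedAddCommGroup V] [NormedSpace ℂ V] [SMul Aᵐᵒᵖ V] [CStarModule Aᵐᵒᵖ V]

/-- The `A`-product `(u, v) ∈ A`, conjugate linear in the first variable. -/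
def aProd (u v : U) : A := MulOpposite.unop (inner Aᵐᵒᵖ u v)

/-- Morphisms of Hilbert `A`-modules: continuous, `A`-linear, adjointable maps. -/
def IsMorphism (F : U →L[ℂ] V) : Prop :=
  (∀ (u : U) (a : A), F (u <• a) = F u <• a) ∧
    ∃ G : V → U, ∀ (u : U) (v : V), aProd A (F u) v = aProd A u (G v)

/-- The elementary operators `u' ↦ v · (u, u')`. -/
def IsElementary (T : U →L[ℂ] V) : Prop :=
  ∃ (u : U) (v : V), ∀ u' : U, T u' = v <• aProd A u u'

variable (U V) in
/-- The operators of `A`-finite rank: finite sums of elementary operators (these are stable under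
complex multiples and under replacing `v` by `v · a`). -/
def finiteRank : Submodule ℂ (U →L[ℂ] V) :=
  Submodule.span ℂ {T : U →L[ℂ] V | IsElementary A T}

/-- The `A`-compact operators: morphisms in the operator norm closure of the operators of
`A`-finite rank. -/
def IsACompact (T : U →L[ℂ] V) : Prop :=
  IsMorphism A T ∧ T ∈ closure (finiteRank A U V : Set (U →L[ℂ] V))

/-- `A`-Fredholm operators: morphisms which are left and right invertible, by morphisms, modulo
`A`-compact operators. -/
def IsAFredholm (F : U →L[ℂ] V) : Prop :=
  IsMorphism A F ∧
  (∃ (G : V →L[ℂ] U) (P : U →L[ℂ] U), IsMorphism A G ∧ IsACompact A P ∧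
    G ∘L F = ContinuousLinearMap.id ℂ U + P) ∧
  (∃ (G : V →L[ℂ] U) (P : V →L[ℂ] V), IsMorphism A G ∧ IsACompact A P ∧
    F ∘L G = ContinuousLinearMap.id ℂ V + P)

/-- The orthogonal complement `{v | (v, w) = 0 for all w ∈ W}` of a subset `W`. -/
def orthogonalComplement (W : Set V) : Submodule ℂ V where
  carrier := {v | ∀ w ∈ W, aProd A v w = 0}
  add_mem' := by
    intro x y hx hy w hw
    have h₁ := hx w hw
    have h₂ := hy w hw
    simp only [aProd] at h₁ h₂ ⊢
    simp [h₁, h₂]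
  zero_mem' := by
    intro w _
    simp [aProd]
  smul_mem' := by
    intro z x hx w hw
    have h₁ := hx w hw
    simp only [aProd] at h₁ ⊢
    simp [h₁]

/-- An orthonormal system: the `(v, v)` are minimal projections of `A`, and different members are
orthogonal. -/
def IsOrthonormalSystem (S : Set V) : Prop :=
  (∀ v ∈ S, IsMinimalProjection (aProd A v v)) ∧
    ∀ v ∈ S, ∀ w ∈ S, v ≠ w → aProd A v w = 0

/-- An orthonormal basis of a closed `A`-submodule `W` of `V` (itself a Hilbert `A`-module with the
restricted structure): an orthonormal system for which the generated `A`-submodule is norm dense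
in `W`. -/
def IsOrthonormalBasis (W : Submodule ℂ V) (S : Set V) : Prop :=
  IsOrthonormalSystem A S ∧
    closure (Submodule.span ℂ (S ∪ {x | ∃ v ∈ S, ∃ a : A, x = v <• a}) : Set V) = (W : Set V)

/-- The dimension `dim_A W` of a closed `A`-submodule `W` of a Hilbert `A`-module: the cardinality
of an orthonormal basis (with `⊤` for all infinite cardinalities).  Over a C*-algebra of compact
operators all orthonormal bases of `W` have the same cardinality; the infimum over
all of them makes this a definition without that fact, and has the value `⊤` if there were none. -/
noncomputable def dimA (W : Submodule ℂ V) : ℕ∞ :=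
  ⨅ (S : Set V) (_ : IsOrthonormalBasis A W S), S.encard

end Modules

end General

end HilbertCStar

set_option linter.unusedSectionVars false

/-! If `S` is a finite orthonormal basis of a submodule, then `∑ v · (v, x)` over `S` is the
orthogonal projection onto it, and this projection has `A`-finite rank. For sufficiency, let `P` and
`Q` be these projections onto `Ker F` and `(Im F)ᗮ`. Closed range makes `D = F*F + P` bounded below.
`D` is also positive, hence invertible, and `G = D⁻¹F*` satisfies `GF = 1 - P` and `FG = 1 - Q`
(`exists_generalized_inverse`). This direction works over any C*-algebra.

Necessity uses compactness of `A`. Functional calculus gives finite rank elements `a` with `y · a`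
close to `y`, so an `A`-compact operator is `∑ (yᵢ · aᵢ)(xᵢ, ·)` up to an error of norm less than
one. Since `1 + error` is invertible, `Ker F` lies in some submodule `∑ yᵢ aᵢ A`; the adjoint of the
second Fredholm equation does the same for `(Im F)ᗮ`. Orthonormal systems in `∑ yᵢ aᵢ A` have
bounded cardinality (`card_le_of_subset_generated`). Every nonzero `x` has a multiple `x · a` whose
square `(x · a, x · a)` is a minimal projection (`exists_act_isMinimalProjection`), so a system of
maximal size spans. The same finite bases exhibit `Im F` as the solution set of a continuous
equation, hence closed (`isClosed_range_of_left_inverse`). -/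

namespace HilbertCStar

/-! ### Calculus of the `A`-product, elementary operators and adjoints. -/

section Module

variable (A : Type*) [NonUnitalCStarAlgebra A] [PartialOrder A]
variable {U V W : Type*}
  [NormedAddCommGroup U] [NormedSpace ℂ U] [SMul Aᵐᵒᵖ U] [CStarModule Aᵐᵒᵖ U]
  [NormedAddCommGroup V] [NormedSpace ℂ V] [SMul Aᵐᵒᵖ V] [CStarModule Aᵐᵒᵖ V]
  [NormedAddCommGroup W] [NormedSpace ℂ W] [SMul Aᵐᵒᵖ W] [CStarModule Aᵐᵒᵖ W]

@[simp] lemma star_aProd (u v : U) : star (aProd A u v) = aProd A v u := by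
  simp [aProd, ← MulOpposite.unop_star]

@[simp] lemma aProd_add_right (u v w : U) :
    aProd A u (v + w) = aProd A u v + aProd A u w := by simp [aProd]

@[simp] lemma aProd_add_left (u v w : U) :
    aProd A (u + v) w = aProd A u w + aProd A v w := by simp [aProd]

@[simp] lemma aProd_sub_right (u v w : U) :
    aProd A u (v - w) = aProd A u v - aProd A u w := by simp [aProd]

@[simp] lemma aProd_sub_left (u v w : U) :
    aProd A (u - v) w = aProd A u w - aProd A v w := by simp [aProd]

@[simp] lemma aProd_neg_right (u v : U) : aProd A u (-v) = -aProd A u v := by simp [aProd]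

@[simp] lemma aProd_neg_left (u v : U) : aProd A (-u) v = -aProd A u v := by simp [aProd]

@[simp] lemma aProd_zero_right (u : U) : aProd A u 0 = 0 := by simp [aProd]

@[simp] lemma aProd_zero_left (u : U) : aProd A 0 u = 0 := by simp [aProd]

@[simp] lemma aProd_smul_right (z : ℂ) (u v : U) : aProd A u (z • v) = z • aProd A u v := by
  simp [aProd]

@[simp] lemma aProd_smul_left (z : ℂ) (u v : U) : aProd A (z • u) v = star z • aProd A u v := by
  simp [aProd]

@[simp] lemma aProd_act_right (u v : U) (a : A) : aProd A u (v <• a) = aProd A u v * a := by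
  simp [aProd]

@[simp] lemma aProd_act_left (u v : U) (a : A) : aProd A (u <• a) v = star a * aProd A u v := by
  rw [← star_aProd, aProd_act_right, star_mul, star_aProd]

lemma aProd_sum_right {ι : Type*} (s : Finset ι) (u : U) (f : ι → U) :
    aProd A u (∑ i ∈ s, f i) = ∑ i ∈ s, aProd A u (f i) := by
  simp [aProd, CStarModule.inner_sum_right]

lemma aProd_sum_left {ι : Type*} (s : Finset ι) (u : U) (f : ι → U) :
    aProd A (∑ i ∈ s, f i) u = ∑ i ∈ s, aProd A (f i) u := by
  simp [aProd, CStarModule.inner_sum_left]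

lemma aProd_self_nonneg (u : U) : 0 ≤ aProd A u u := by
  have := CStarModule.inner_self_nonneg (A := Aᵐᵒᵖ) (x := u)
  exact this

lemma aProd_self_eq_zero {u : U} : aProd A u u = 0 ↔ u = 0 := by
  rw [aProd, MulOpposite.unop_eq_zero_iff, CStarModule.inner_self]

lemma norm_sq_eq_norm_aProd (u : U) : ‖u‖ ^ 2 = ‖aProd A u u‖ := by
  rw [CStarModule.norm_sq_eq Aᵐᵒᵖ]; rfl

/-- The action is only an `SMul`, so the module axioms below are all derived by testing against the
product. -/
lemma eq_of_aProd_right {u v : U} (h : ∀ w : U, aProd A w u = aProd A w v) : u = v := by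
  rw [← sub_eq_zero, ← aProd_self_eq_zero A, aProd_sub_right, h, sub_self]

lemma add_act (u v : U) (a : A) : (u + v) <• a = u <• a + v <• a :=
  eq_of_aProd_right A fun w => by simp [add_mul]

lemma neg_act (u : U) (a : A) : (-u) <• a = -(u <• a) :=
  eq_of_aProd_right A fun w => by simp

lemma sub_act (u v : U) (a : A) : (u - v) <• a = u <• a - v <• a :=
  eq_of_aProd_right A fun w => by simp [sub_mul]

lemma smul_act (z : ℂ) (u : U) (a : A) : (z • u) <• a = z • (u <• a) :=
  eq_of_aProd_right A fun w => by simp [smul_mul_assoc]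

lemma act_add (u : U) (a b : A) : u <• (a + b) = u <• a + u <• b :=
  eq_of_aProd_right A fun w => by simp only [aProd_act_right, aProd_add_right, mul_add]

lemma act_smul (z : ℂ) (u : U) (a : A) : u <• (z • a) = z • (u <• a) :=
  eq_of_aProd_right A fun w => by simp only [aProd_act_right, aProd_smul_right, mul_smul_comm]

lemma act_mul (u : U) (a b : A) : u <• (a * b) = (u <• a) <• b :=
  eq_of_aProd_right A fun w => by simp only [aProd_act_right, mul_assoc]

lemma act_zero (u : U) : u <• (0 : A) = 0 :=
  eq_of_aProd_right A fun w => by simp only [aProd_act_right, aProd_zero_right, mul_zero]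

lemma zero_act (a : A) : (0 : U) <• a = 0 :=
  eq_of_aProd_right A fun w => by simp

lemma sum_act {ι : Type*} (s : Finset ι) (f : ι → U) (a : A) :
    (∑ i ∈ s, f i) <• a = ∑ i ∈ s, f i <• a :=
  eq_of_aProd_right A fun w => by simp [aProd_sum_right, Finset.sum_mul]

lemma act_aProd_self_of_isStarProjection {v : U} (hv : IsStarProjection (aProd A v v)) :
    v <• aProd A v v = v := by
  rw [← sub_eq_zero, ← aProd_self_eq_zero A]
  have := hv.isIdempotentElem.eq
  simp [this]

variable [StarOrderedRing A]

lemma norm_aProd_le (u v : U) : ‖aProd A u v‖ ≤ ‖u‖ * ‖v‖ := by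
  have := CStarModule.norm_inner_le (A := Aᵐᵒᵖ) U (x := u) (y := v)
  exact this

lemma norm_act_le (u : U) (a : A) : ‖u <• a‖ ≤ ‖u‖ * ‖a‖ := by
  refine (pow_le_pow_iff_left₀ (norm_nonneg _) (by positivity) two_ne_zero).mp ?_
  rw [norm_sq_eq_norm_aProd A, aProd_act_right, aProd_act_left, mul_pow,
    norm_sq_eq_norm_aProd A u]
  calc _ ≤ ‖star a‖ * ‖aProd A u u‖ * ‖a‖ := norm_mul₃_le
    _ = _ := by rw [norm_star]; ring

lemma continuous_aProd_right (u : U) : Continuous (fun v : U => aProd A u v) := by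
  have := (CStarModule.innerSL (A := Aᵐᵒᵖ) u).continuous
  exact MulOpposite.continuous_unop.comp this

lemma continuous_aProd_left (u : U) : Continuous (fun v : U => aProd A v u) := by
  simp_rw [← star_aProd A u]
  exact (continuous_aProd_right A u).star

/-- The elementary operator `x ↦ v · (u, x)`. -/
noncomputable def rankOne (v : V) (u : U) : U →L[ℂ] V :=
  LinearMap.mkContinuous
    { toFun := fun x => v <• aProd A u x
      map_add' := fun x y => by rw [aProd_add_right, act_add]
      map_smul' := fun z x => by rw [aProd_smul_right, act_smul, RingHom.id_apply] } (‖v‖ * ‖u‖) fun x => by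
    calc _ ≤ ‖v‖ * ‖aProd A u x‖ := norm_act_le A v _
      _ ≤ ‖v‖ * (‖u‖ * ‖x‖) := by gcongr; exact norm_aProd_le A u x
      _ = _ := by ring

lemma rankOne_apply (v : V) (u x : U) : rankOne A v u x = v <• aProd A u x := rfl

lemma norm_rankOne_le (v : V) (u : U) : ‖rankOne A v u‖ ≤ ‖v‖ * ‖u‖ :=
  LinearMap.mkContinuous_norm_le _ (by positivity) _

lemma rankOne_sub_left (v v' : V) (u : U) :
    rankOne A (v - v') u = rankOne A v u - rankOne A v' u := by
  ext x; simp [rankOne_apply, sub_act]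

lemma rankOne_mem_finiteRank (v : V) (u : U) : rankOne A v u ∈ finiteRank A U V :=
  Submodule.subset_span ⟨u, v, fun _ => rfl⟩

/-- `G` is the adjoint of `F`. -/
def IsAdjoint (F : U →L[ℂ] V) (G : V →L[ℂ] U) : Prop :=
  ∀ u v, aProd A (F u) v = aProd A u (G v)

/-- Linearity over `A`. -/
def IsALinear (F : U →L[ℂ] V) : Prop := ∀ (u : U) (a : A), F (u <• a) = F u <• a

variable {A}

lemma IsAdjoint.symm {F : U →L[ℂ] V} {G : V →L[ℂ] U} (h : IsAdjoint A F G) : IsAdjoint A G F :=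
  fun v u => by rw [← star_aProd, ← h, star_aProd]

lemma IsAdjoint.isALinear {F : U →L[ℂ] V} {G : V →L[ℂ] U} (h : IsAdjoint A F G) :
    IsALinear A F := fun u a => eq_of_aProd_right A fun w => by
  rw [← h.symm, aProd_act_right, aProd_act_right, h.symm]

lemma IsAdjoint.isMorphism {F : U →L[ℂ] V} {G : V →L[ℂ] U} (h : IsAdjoint A F G) :
    IsMorphism A F := ⟨h.isALinear, G, h⟩

lemma IsAdjoint.norm_le {F : U →L[ℂ] V} {G : V →L[ℂ] U} (h : IsAdjoint A F G) : ‖G‖ ≤ ‖F‖ := by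
  refine G.opNorm_le_bound (norm_nonneg _) fun v => ?_
  have key : ‖G v‖ * ‖G v‖ ≤ ‖F‖ * ‖v‖ * ‖G v‖ := by
    rw [← sq, norm_sq_eq_norm_aProd A, ← h]
    calc _ ≤ ‖F (G v)‖ * ‖v‖ := norm_aProd_le A _ _
      _ ≤ ‖F‖ * ‖G v‖ * ‖v‖ := by gcongr; exact F.le_opNorm _
      _ = _ := by ring
  rcases (norm_nonneg (G v)).eq_or_lt with h0 | h0
  · rw [← h0]; positivity
  · exact le_of_mul_le_mul_right key h0

/-- Linearity of the adjoint follows from nondegeneracy of the product, and boundedness from `‖G v‖²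
= ‖(F (G v), v)‖ ≤ ‖F‖ ‖G v‖ ‖v‖`. -/
lemma IsMorphism.exists_isAdjoint {F : U →L[ℂ] V} (hF : IsMorphism A F) :
    ∃ G : V →L[ℂ] U, IsAdjoint A F G := by
  obtain ⟨-, G, hG⟩ := hF
  refine ⟨LinearMap.mkContinuous
    { toFun := G
      map_add' := fun x y => eq_of_aProd_right A fun w => by
        rw [← hG, aProd_add_right, aProd_add_right, hG, hG]
      map_smul' := fun z x => eq_of_aProd_right A fun w => by
        rw [← hG, aProd_smul_right, RingHom.id_apply, aProd_smul_right, hG] } ‖F‖ fun v => ?_, hG⟩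
  change ‖G v‖ ≤ _
  have key : ‖G v‖ * ‖G v‖ ≤ ‖F‖ * ‖v‖ * ‖G v‖ := by
    rw [← sq, norm_sq_eq_norm_aProd A, ← hG]
    calc _ ≤ ‖F (G v)‖ * ‖v‖ := norm_aProd_le A _ _
      _ ≤ ‖F‖ * ‖G v‖ * ‖v‖ := by gcongr; exact F.le_opNorm _
      _ = _ := by ring
  rcases (norm_nonneg (G v)).eq_or_lt with h0 | h0
  · rw [← h0]; positivity
  · exact le_of_mul_le_mul_right key h0

lemma IsAdjoint.comp {F : U →L[ℂ] V} {F' : V →L[ℂ] U} {G : V →L[ℂ] W} {G' : W →L[ℂ] V}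
    (hG : IsAdjoint A G G') (hF : IsAdjoint A F F') : IsAdjoint A (G ∘L F) (F' ∘L G') :=
  fun u v => by simp only [ContinuousLinearMap.comp_apply]; rw [hG, hF]

lemma IsAdjoint.add {F G : U →L[ℂ] V} {F' G' : V →L[ℂ] U}
    (hF : IsAdjoint A F F') (hG : IsAdjoint A G G') : IsAdjoint A (F + G) (F' + G') :=
  fun u v => by simp [hF u v, hG u v]

lemma IsAdjoint.sub {F G : U →L[ℂ] V} {F' G' : V →L[ℂ] U}
    (hF : IsAdjoint A F F') (hG : IsAdjoint A G G') : IsAdjoint A (F - G) (F' - G') :=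
  fun u v => by simp [hF u v, hG u v]

lemma IsAdjoint.sum {ι : Type*} (s : Finset ι) {F : ι → U →L[ℂ] V} {F' : ι → V →L[ℂ] U}
    (h : ∀ i ∈ s, IsAdjoint A (F i) (F' i)) : IsAdjoint A (∑ i ∈ s, F i) (∑ i ∈ s, F' i) :=
  fun u v => by
    simp only [sum_apply, aProd_sum_left, aProd_sum_right]
    exact Finset.sum_congr rfl fun i hi => h i hi u v

lemma isAdjoint_rankOne (v : V) (u : U) : IsAdjoint A (rankOne A v u) (rankOne A u v) :=
  fun x y => by simp [rankOne_apply]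

lemma IsALinear.comp {G : V →L[ℂ] W} {F : U →L[ℂ] V} (hG : IsALinear A G) (hF : IsALinear A F) :
    IsALinear A (G ∘L F) := fun u a => by simp [hF u a, hG (F u) a]

lemma IsALinear.sub {F G : U →L[ℂ] V} (hF : IsALinear A F) (hG : IsALinear A G) :
    IsALinear A (F - G) := fun u a => by simp [hF u a, hG u a, sub_act]

end Module

/-! ### Closed range and finite dimensions imply Fredholm. -/

section Sufficiency

variable {A : Type*} [NonUnitalCStarAlgebra A] [PartialOrder A] [StarOrderedRing A]
variable {U V : Type*}
  [NormedAddCommGroup U] [NormedSpace ℂ U] [SMul Aᵐᵒᵖ U] [CStarModule Aᵐᵒᵖ U]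
  [NormedAddCommGroup V] [NormedSpace ℂ V] [SMul Aᵐᵒᵖ V] [CStarModule Aᵐᵒᵖ V]

/-- The square of `(D + t) x` is `(Dx, Dx) + 2t (x, Dx) + t² (x, x)`, which dominates `(Dx, Dx)` in
the order of `A`. -/
lemma norm_le_norm_add_smul_of_nonneg {D : U →L[ℂ] U} (hD : IsAdjoint A D D)
    (hpos : ∀ x, 0 ≤ aProd A x (D x)) {t : ℝ} (ht : 0 ≤ t) (x : U) :
    ‖D x‖ ≤ ‖(D + (t : ℂ) • (1 : U →L[ℂ] U)) x‖ := by
  refine (pow_le_pow_iff_left₀ (norm_nonneg _) (by positivity) two_ne_zero).mp ?_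
  rw [norm_sq_eq_norm_aProd A, norm_sq_eq_norm_aProd A]
  refine CStarAlgebra.norm_le_norm_of_nonneg_of_le (aProd_self_nonneg A _) ?_
  have h : aProd A ((D + (t : ℂ) • (1 : U →L[ℂ] U)) x) ((D + (t : ℂ) • (1 : U →L[ℂ] U)) x)
      = aProd A (D x) (D x) + (t • aProd A x (D x) + t • aProd A x (D x)
        + t • t • aProd A x x) := by
    change aProd A (D x + (t : ℂ) • x) (D x + (t : ℂ) • x) = _
    rw [aProd_add_left, aProd_add_right, aProd_add_right, aProd_smul_left, aProd_smul_left,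
      aProd_smul_right, aProd_smul_right, hD x x]
    simp only [RCLike.star_def, Complex.conj_ofReal, Complex.coe_smul]
    abel
  rw [h]
  have h1 := smul_nonneg ht (hpos x)
  have h2 := smul_nonneg ht (smul_nonneg ht (aProd_self_nonneg A x))
  exact le_add_of_nonneg_right (add_nonneg (add_nonneg h1 h1) h2)

/-- Continuity method along `D + t`, `t ≥ 0`. Every inverse met on the way has norm at most `C`, so
invertibility passes from `t` to any `s ≥ 0` closer than `1 / C`. Starting from a large `t₀`,
finitely many steps of length `1 / (2C)` reach `0`. -/
lemma isUnit_of_nonneg_of_bounded_below [CompleteSpace U] {D : U →L[ℂ] U} (hD : IsAdjoint A D D)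
    (hpos : ∀ x, 0 ≤ aProd A x (D x)) {C : ℝ} (hC : 0 < C) (hbound : ∀ x, ‖x‖ ≤ C * ‖D x‖) :
    IsUnit D := by
  set T : ℝ → (U →L[ℂ] U) := fun t => D + (t : ℂ) • (1 : U →L[ℂ] U) with hT
  have step : ∀ s t : ℝ, 0 ≤ t → |s - t| * C < 1 → IsUnit (T t) → IsUnit (T s) := by
    rintro s t ht hst ⟨u, hu⟩
    have hn : ‖(↑u⁻¹ : U →L[ℂ] U)‖ ≤ C := by
      refine ContinuousLinearMap.opNorm_le_bound _ hC.le fun x => ?_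
      have h1 := norm_le_norm_add_smul_of_nonneg hD hpos ht ((↑u⁻¹ : U →L[ℂ] U) x)
      have h2 : T t ((↑u⁻¹ : U →L[ℂ] U) x) = x := by
        rw [← hu, ← mul_apply_eq_comp, Units.mul_inv, one_apply_eq_self]
      change _ ≤ ‖T t _‖ at h1
      rw [h2] at h1
      exact (hbound _).trans (by gcongr)
    have hs : T s = u * (1 - ((t - s : ℝ) : ℂ) • (↑u⁻¹ : U →L[ℂ] U)) := by
      rw [mul_sub, mul_one, mul_smul_comm, Units.mul_inv, hu]
      simp only [hT]
      push_cast
      module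
    rw [hs]
    refine u.isUnit.mul (isUnit_one_sub_of_norm_lt_one ?_)
    calc _ ≤ |s - t| * C := by
          rw [norm_smul, Complex.norm_real, Real.norm_eq_abs, abs_sub_comm]
          gcongr
      _ < 1 := hst
  obtain ⟨t₀, ht₀, hu₀⟩ : ∃ t₀ : ℝ, 0 ≤ t₀ ∧ IsUnit (T t₀) := by
    refine ⟨‖D‖ * ‖(1 : U →L[ℂ] U)‖ + 1, by positivity, ?_⟩
    have hmem : (-((‖D‖ * ‖(1 : U →L[ℂ] U)‖ + 1 : ℝ) : ℂ)) ∈ resolventSet ℂ D := by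
      refine spectrum.mem_resolventSet_of_norm_lt_mul ?_
      rw [norm_neg, Complex.norm_real, Real.norm_eq_abs]
      exact (lt_add_one _).trans_le (le_abs_self _)
    rw [spectrum.mem_resolventSet_iff, Algebra.algebraMap_eq_smul_one] at hmem
    convert hmem.neg using 1
    simp only [hT]
    module
  have key : ∀ n : ℕ, IsUnit (T (max 0 (t₀ - n * (1 / (2 * C))))) := by
    intro n
    induction n with
    | zero => simpa [ht₀] using hu₀
    | succ n ih =>
      refine step _ _ (le_max_left _ _) ?_ ih
      have hle : |max 0 (t₀ - (n + 1 : ℕ) * (1 / (2 * C))) - max 0 (t₀ - n * (1 / (2 * C)))|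
          ≤ |(t₀ - (n + 1 : ℕ) * (1 / (2 * C))) - (t₀ - n * (1 / (2 * C)))| := by
        rw [max_comm 0, max_comm 0]
        exact abs_max_sub_max_le_abs _ _ _
      calc _ ≤ |(t₀ - (n + 1 : ℕ) * (1 / (2 * C))) - (t₀ - n * (1 / (2 * C)))| * C := by
            gcongr
        _ < 1 := by
            have : (t₀ - (n + 1 : ℕ) * (1 / (2 * C))) - (t₀ - n * (1 / (2 * C)))
              = -(1 / (2 * C)) := by push_cast; ring
            rw [this, abs_neg, abs_of_pos (by positivity)]
            field_simp
            norm_num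
  obtain ⟨n, hn⟩ := exists_nat_ge (t₀ * (2 * C))
  have h := key n
  have h0 : t₀ - n * (1 / (2 * C)) ≤ 0 := by
    rw [sub_nonpos, mul_one_div, le_div_iff₀ (by positivity)]
    exact hn
  rw [max_eq_left h0] at h
  simpa [hT] using h

lemma exists_generalized_inverse [CompleteSpace U] {F : U →L[ℂ] V} {F' : V →L[ℂ] U}
    (hF : IsAdjoint A F F') {P : U →L[ℂ] U} (hP : IsAdjoint A P P) (hPP : P * P = P)
    (hFP : F ∘L P = 0) {C : ℝ} (hC : 0 ≤ C) (hbound : ∀ x, ‖x - P x‖ ≤ C * ‖F x‖) :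
    ∃ G : V →L[ℂ] U, IsMorphism A G ∧ G ∘L F = 1 - P ∧ F' ∘L (F ∘L G) = F' := by
  set D : U →L[ℂ] U := F' ∘L F + P with hDdef
  have hD : IsAdjoint A D D := (hF.symm.comp hF).add hP
  have hPx : ∀ x, P (P x) = P x := fun x => congrArg (fun T : U →L[ℂ] U => T x) hPP
  have hFPx : ∀ x, F (P x) = 0 := fun x => congrArg (fun T : U →L[ℂ] V => T x) hFP
  have hinner : ∀ x, aProd A x (D x) = aProd A (F x) (F x) + aProd A (P x) (P x) := fun x => by
    simp only [hDdef, add_apply, ContinuousLinearMap.comp_apply,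
      aProd_add_right]
    rw [hF, hP x (P x), hPx]
  have hpos : ∀ x, 0 ≤ aProd A x (D x) := fun x => by
    rw [hinner]; exact add_nonneg (aProd_self_nonneg A _) (aProd_self_nonneg A _)
  -- By `hinner`, both `‖F x‖²` and `‖P x‖²` are at most `‖x‖ ‖D x‖`. Splitting `x = P x + (x - P
  -- x)` then gives `‖x‖ ≤ (1 + C) √(‖x‖ ‖D x‖)`.
  have hbelow : ∀ x, ‖x‖ ≤ (1 + C) ^ 2 * ‖D x‖ := fun x => by
    have h1 : ‖F x‖ ^ 2 ≤ ‖x‖ * ‖D x‖ := by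
      refine le_trans ?_ (norm_aProd_le A x (D x))
      rw [norm_sq_eq_norm_aProd A, hinner]
      exact CStarAlgebra.norm_le_norm_of_nonneg_of_le (aProd_self_nonneg A _)
        (le_add_of_nonneg_right (aProd_self_nonneg A _))
    have h2 : ‖P x‖ ^ 2 ≤ ‖x‖ * ‖D x‖ := by
      refine le_trans ?_ (norm_aProd_le A x (D x))
      rw [norm_sq_eq_norm_aProd A, hinner]
      exact CStarAlgebra.norm_le_norm_of_nonneg_of_le (aProd_self_nonneg A _)
        (le_add_of_nonneg_left (aProd_self_nonneg A _))
    have h3 : ‖x‖ ≤ (1 + C) * √(‖x‖ * ‖D x‖) := by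
      calc ‖x‖ = ‖P x + (x - P x)‖ := by rw [add_sub_cancel]
        _ ≤ ‖P x‖ + ‖x - P x‖ := norm_add_le _ _
        _ ≤ ‖P x‖ + C * ‖F x‖ := by gcongr; exact hbound x
        _ ≤ √(‖x‖ * ‖D x‖) + C * √(‖x‖ * ‖D x‖) := by
            gcongr <;> exact Real.le_sqrt_of_sq_le ‹_›
        _ = _ := by ring
    have h4 : ‖x‖ ^ 2 ≤ (1 + C) ^ 2 * (‖x‖ * ‖D x‖) := by
      calc ‖x‖ ^ 2 ≤ ((1 + C) * √(‖x‖ * ‖D x‖)) ^ 2 := by gcongr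
        _ = _ := by rw [mul_pow, Real.sq_sqrt (by positivity)]
    rcases (norm_nonneg x).eq_or_lt with h0 | h0
    · rw [← h0]; positivity
    · refine le_of_mul_le_mul_right ?_ h0
      linarith
  obtain ⟨u, hu⟩ := isUnit_of_nonneg_of_bounded_below hD hpos (by positivity) hbelow
  set W : U →L[ℂ] U := ↑u⁻¹ with hW
  have hDW : ∀ x, D (W x) = x := fun x => by
    rw [← hu, ← mul_apply_eq_comp, Units.mul_inv, one_apply_eq_self]
  have hWD : ∀ x, W (D x) = x := fun x => by
    rw [← hu, ← mul_apply_eq_comp, Units.inv_mul, one_apply_eq_self]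
  have hWadj : IsAdjoint A W W := fun x y => by
    calc aProd A (W x) y = aProd A (W x) (D (W y)) := by rw [hDW]
      _ = aProd A x (W y) := by rw [← hD, hDW]
  have hPF' : ∀ v, P (F' v) = 0 := fun v => eq_of_aProd_right A fun w => by
    rw [← hP, ← hF, hFPx, aProd_zero_left, aProd_zero_right]
  have hF'F : ∀ x, F' (F x) = D x - P x := fun x => by simp [hDdef]
  have hWP : ∀ x, W (P x) = P x := fun x => by
    conv_rhs => rw [← hWD (P x)]
    simp [hDdef, hFPx, hPx]
  have hPW : ∀ x, P (W x) = P x := fun x => eq_of_aProd_right A fun w => by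
    rw [← hP, ← hWadj, hWP, hP]
  refine ⟨W ∘L F', (hWadj.comp hF.symm).isMorphism, ?_, ?_⟩
  · ext x
    simp [hF'F, hWD, hWP]
  · ext v
    simp [hF'F, hDW, hPW, hPF']

variable (A) in
/-- The operator `∑ v · (v, x)`, the orthogonal projection onto the submodule generated by `S` when
`S` is an orthonormal system. -/
noncomputable def finsetProj (S : Finset V) : V →L[ℂ] V := ∑ v ∈ S, rankOne A v v

lemma finsetProj_apply (S : Finset V) (x : V) :
    finsetProj A S x = ∑ v ∈ S, v <• aProd A v x := by
  simp [finsetProj, rankOne_apply]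

lemma isAdjoint_finsetProj (S : Finset V) : IsAdjoint A (finsetProj A S) (finsetProj A S) :=
  IsAdjoint.sum S fun v _ => isAdjoint_rankOne v v

lemma finsetProj_mem_finiteRank (S : Finset V) : finsetProj A S ∈ finiteRank A V V :=
  Submodule.sum_mem _ fun v _ => rankOne_mem_finiteRank A v v

lemma IsOrthonormalSystem.finsetProj_apply_self {S : Finset V}
    (hS : IsOrthonormalSystem A (S : Set V)) {v : V} (hv : v ∈ S) : finsetProj A S v = v := by
  rw [finsetProj_apply, Finset.sum_eq_single_of_mem v hv]
  · exact act_aProd_self_of_isStarProjection A (hS.1 v hv).1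
  · intro w hw hwv
    rw [hS.2 w hw v hv hwv, act_zero]

lemma IsOrthonormalBasis.finsetProj_mem {W : Submodule ℂ V} {S : Finset V}
    (hS : IsOrthonormalBasis A W (S : Set V)) (x : V) : finsetProj A S x ∈ W := by
  rw [finsetProj_apply]
  refine Submodule.sum_mem _ fun v hv => ?_
  rw [← SetLike.mem_coe, ← hS.2]
  exact subset_closure (Submodule.subset_span (Or.inr ⟨v, hv, _, rfl⟩))

lemma IsOrthonormalBasis.finsetProj_eq {W : Submodule ℂ V} {S : Finset V}
    (hS : IsOrthonormalBasis A W (S : Set V)) {x : V} (hx : x ∈ W) : finsetProj A S x = x := by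
  have hclosed : IsClosed {x : V | finsetProj A S x = x} :=
    isClosed_eq (finsetProj A S).continuous continuous_id
  rw [← SetLike.mem_coe, ← hS.2] at hx
  refine closure_minimal (fun y hy => ?_) hclosed hx
  induction hy using Submodule.span_induction with
  | mem y hy =>
    rcases hy with hy | ⟨v, hv, a, rfl⟩
    · exact hS.1.finsetProj_apply_self hy
    · change finsetProj A S _ = _
      rw [(isAdjoint_finsetProj S).isALinear, hS.1.finsetProj_apply_self hv]
  | zero => exact map_zero _
  | add y z _ _ hy hz => exact (map_add _ _ _).trans (congrArg₂ _ hy hz)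
  | smul c y _ hy => exact (map_smul _ _ _).trans (congrArg _ hy)

lemma exists_finset_of_dimA_lt_top {W : Submodule ℂ V} (h : dimA A W < ⊤) :
    ∃ S : Finset V, IsOrthonormalBasis A W (S : Set V) := by
  -- An infimum over no bases would be `⊤`, so finiteness produces a basis.
  simp only [dimA, iInf_lt_iff, Set.encard_lt_top_iff] at h
  obtain ⟨S, hS, hfin⟩ := h
  exact ⟨hfin.toFinset, by simpa using hS⟩

lemma isACompact_neg_of_mem_finiteRank {P : U →L[ℂ] V} {P' : V →L[ℂ] U} (h : IsAdjoint A P P')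
    (hP : P ∈ finiteRank A U V) : IsACompact A (-P) := by
  refine ⟨IsAdjoint.isMorphism (G := -P') fun u v => by simp [h u v], subset_closure ?_⟩
  exact Submodule.neg_mem _ hP

theorem isAFredholm_of_isClosed_range [CompleteSpace U] [CompleteSpace V] {F : U →L[ℂ] V}
    (hF : IsMorphism A F) (hcl : IsClosed (Set.range F))
    (hker : dimA A (LinearMap.ker (F : U →ₗ[ℂ] V)) < ⊤)
    (hcoker : dimA A (orthogonalComplement A (Set.range F)) < ⊤) : IsAFredholm A F := by
  obtain ⟨F', hF'⟩ := hF.exists_isAdjoint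
  obtain ⟨S, hS⟩ := exists_finset_of_dimA_lt_top hker
  obtain ⟨T, hT⟩ := exists_finset_of_dimA_lt_top hcoker
  -- Open mapping theorem for `F` onto its closed, hence complete, range.
  obtain ⟨C, hC, hpre⟩ : ∃ C, 0 ≤ C ∧ ∀ x, ∃ x', F x' = F x ∧ ‖x'‖ ≤ C * ‖F x‖ := by
    have : CompleteSpace (LinearMap.range (F : U →ₗ[ℂ] V)) :=
      (show IsClosed (LinearMap.range (F : U →ₗ[ℂ] V) : Set V) from hcl).completeSpace_coe
    obtain ⟨C, hC, h⟩ := F.rangeRestrict.exists_preimage_norm_le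
      (by rintro ⟨_, x, rfl⟩; exact ⟨x, rfl⟩)
    refine ⟨C, hC.le, fun x => ?_⟩
    obtain ⟨x', h1, h2⟩ := h ⟨F x, x, rfl⟩
    exact ⟨x', congrArg Subtype.val h1, h2⟩
  set P := finsetProj A S
  set Q := finsetProj A T
  have hFP : ∀ x, F (P x) = 0 := fun x => hS.finsetProj_mem x
  have hbound : ∀ x, ‖x - P x‖ ≤ ‖(1 : U →L[ℂ] U) - P‖ * C * ‖F x‖ := fun x => by
    obtain ⟨x', h1, h2⟩ := hpre x
    have h3 : P (x - x') = x - x' := hS.finsetProj_eq (by simp [h1])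
    -- `x` and its controlled preimage `x'` differ by an element of the kernel, which `1 - P` kills.
    have h4 : x - P x = ((1 : U →L[ℂ] U) - P) x' := by
      rw [map_sub] at h3
      simp only [sub_apply, one_apply_eq_self]
      rw [sub_eq_sub_iff_sub_eq_sub, h3]
    rw [h4, mul_assoc]
    exact (ContinuousLinearMap.le_opNorm _ _).trans (by gcongr)
  obtain ⟨G, hG, hGF, hFG⟩ := exists_generalized_inverse hF' (isAdjoint_finsetProj S)
    (ContinuousLinearMap.ext fun x => hS.finsetProj_eq (hS.finsetProj_mem x))
    (ContinuousLinearMap.ext hFP) (by positivity) hbound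
  refine ⟨hF, ⟨G, -P, hG, isACompact_neg_of_mem_finiteRank (isAdjoint_finsetProj S)
    (finsetProj_mem_finiteRank S), hGF.trans (sub_eq_add_neg _ _)⟩, ⟨G, -Q, hG, isACompact_neg_of_mem_finiteRank
    (isAdjoint_finsetProj T) (finsetProj_mem_finiteRank T), ?_⟩⟩
  have hQF : ∀ x, Q (F x) = 0 := fun x => eq_of_aProd_right A fun w => by
    rw [← isAdjoint_finsetProj T, hT.finsetProj_mem w _ ⟨x, rfl⟩, aProd_zero_right]
  ext v
  have hmem : v - F (G v) ∈ orthogonalComplement A (Set.range F) := by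
    rintro _ ⟨x, rfl⟩
    have h := congrArg (fun T : V →L[ℂ] U => T v) hFG
    simp only [ContinuousLinearMap.comp_apply] at h
    rw [← hF'.symm, map_sub, h, sub_self, aProd_zero_left]
  have h := hT.finsetProj_eq hmem
  rw [map_sub, hQF, sub_zero] at h
  have h' : Q v = v - F (G v) := h
  simp [h']

end Sufficiency

/-! ### Finite rank approximation and minimal projections in an algebra of compact operators. -/

section CompactAlgebra

variable {A : Type*} [NonUnitalCStarAlgebra A] [PartialOrder A] [StarOrderedRing A]
variable {H : Type*} [NormedAddCommGroup H] [InnerProductSpace ℂ H] [CompleteSpace H]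
  {φ : A →⋆ₙₐ[ℂ] (H →L[ℂ] H)}

/-- The operator `φ a` has finite rank. -/
def HasFiniteRank (φ : A →⋆ₙₐ[ℂ] (H →L[ℂ] H)) (a : A) : Prop :=
  FiniteDimensional ℂ (LinearMap.range (φ a : H →ₗ[ℂ] H))

/-- On this kernel `T` is the identity, and a space with compact identity is finite dimensional. -/
lemma finiteDimensional_ker_sub_one {T : H →L[ℂ] H} (hT : IsCompactOperator T) :
    FiniteDimensional ℂ (LinearMap.ker ((T - 1 : H →L[ℂ] H) : H →ₗ[ℂ] H)) := by
  set K := LinearMap.ker ((T - 1 : H →L[ℂ] H) : H →ₗ[ℂ] H) with hK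
  have hmem : ∀ v ∈ K, T v = v := fun v hv => sub_eq_zero.mp hv
  have : CompleteSpace K := (ContinuousLinearMap.isClosed_ker (T - 1)).completeSpace_coe
  have hV : ∀ v ∈ K, (T : H →ₗ[ℂ] H) v ∈ K := fun v hv => by
    change T v ∈ K
    rwa [hmem v hv]
  refine FiniteDimensional.of_isCompactOperator_id (𝕜 := ℂ) ?_
  have h := IsCompactOperator.restrict' (f := (T : H →ₗ[ℂ] H)) hT hV
  have heq : (id : K → K) = (T : H →ₗ[ℂ] H).restrict hV :=
    funext fun v => Subtype.ext (hmem v v.2).symm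
  rw [heq]
  exact h

lemma exists_approximate_unit (hφ : ∀ a, IsCompactOperator (φ a)) {b : A} (hb : IsSelfAdjoint b)
    {ε : ℝ} (hε : 0 < ε) : ∃ a : A, IsSelfAdjoint a ∧ HasFiniteRank φ a ∧
      ‖b - b * a - a * b + a * b * a‖ ≤ ε := by
  -- `f` vanishes for `|t| ≤ ε/2` and equals `1` for `|t| ≥ ε`, while `g` is `1` wherever `f` is
  -- nonzero. Hence `g f = f`, which puts the range of `φ (f b)` inside the eigenspace of the
  -- compact operator `φ (g b)` for the eigenvalue `1`.
  set f : ℝ → ℝ := fun t => min 1 (max 0 (|t| / (ε / 2) - 1)) with hf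
  set g : ℝ → ℝ := fun t => min 1 (|t| / (ε / 2)) with hg
  have hfc : Continuous f := by fun_prop
  have hgc : Continuous g := by fun_prop
  have hf0 : f 0 = 0 := by simp [hf]
  have hg0 : g 0 = 0 := by simp [hg]
  have hgf : ∀ t, g t * f t = f t := fun t => by
    rcases le_total (|t| / (ε / 2)) 1 with h | h
    · have : f t = 0 := by simp [hf, max_eq_left (sub_nonpos.mpr h)]
      rw [this, mul_zero]
    · have : g t = 1 := min_eq_left h
      rw [this, one_mul]
  have hfin : HasFiniteRank φ (cfcₙ f b) := by
    have := finiteDimensional_ker_sub_one (hφ (cfcₙ g b))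
    refine Submodule.finiteDimensional_of_le (S₂ := LinearMap.ker
      ((φ (cfcₙ g b) - 1 : H →L[ℂ] H) : H →ₗ[ℂ] H)) ?_
    rintro _ ⟨h, rfl⟩
    have hmul : cfcₙ g b * cfcₙ f b = cfcₙ f b := by
      rw [← cfcₙ_mul g f b hgc.continuousOn hg0 hfc.continuousOn hf0]
      simp_rw [hgf]
    have := congrArg (fun a => φ a h) hmul
    simp only [map_mul, mul_apply_eq_comp] at this
    exact sub_eq_zero.mpr this
  refine ⟨cfcₙ f b, cfcₙ_predicate f b, hfin, ?_⟩
  have h1 : b * cfcₙ f b = cfcₙ (fun t => t * f t) b := by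
    rw [cfcₙ_mul (fun t => t) f b (by fun_prop) rfl hfc.continuousOn hf0, cfcₙ_id' ℝ b]
  have h2 : cfcₙ f b * b = cfcₙ (fun t => f t * t) b := by
    rw [cfcₙ_mul f (fun t => t) b hfc.continuousOn hf0 (by fun_prop) rfl, cfcₙ_id' ℝ b]
  have h3 : cfcₙ f b * b * cfcₙ f b = cfcₙ (fun t => f t * t * f t) b := by
    rw [h2, ← cfcₙ_mul (fun t => f t * t) f b (by fun_prop) (by simp) hfc.continuousOn hf0]
  have h4 : b - b * cfcₙ f b - cfcₙ f b * b + cfcₙ f b * b * cfcₙ f b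
      = cfcₙ (fun t => t - t * f t - f t * t + f t * t * f t) b := by
    rw [cfcₙ_add (fun t => t - t * f t - f t * t) (fun t => f t * t * f t) b (by fun_prop)
      (by simp) (by fun_prop) (by simp),
      cfcₙ_sub (fun t => t - t * f t) (fun t => f t * t) b (by fun_prop)
      (by simp) (by fun_prop) (by simp),
      cfcₙ_sub (fun t => t) (fun t => t * f t) b (by fun_prop)
      (by simp) (by fun_prop) (by simp), ← h1, ← h3, ← h2, cfcₙ_id' ℝ b]
  rw [h4]
  refine norm_cfcₙ_le fun t _ => ?_
  -- The error is the function `t (1 - f t)²` of `b`: at most `|t|` for `|t| ≤ ε`, and zero beyond.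
  have heq : t - t * f t - f t * t + f t * t * f t = t * (1 - f t) ^ 2 := by ring
  rw [heq, Real.norm_eq_abs, abs_mul, abs_of_nonneg (sq_nonneg (1 - f t))]
  rcases le_total |t| ε with h | h
  · have h0 : 0 ≤ f t := le_min zero_le_one (le_max_left _ _)
    have h1 : f t ≤ 1 := min_le_left _ _
    have h2 : (1 - f t) ^ 2 ≤ 1 := by nlinarith
    calc |t| * (1 - f t) ^ 2 ≤ ε * 1 := by gcongr
      _ = ε := mul_one _
  · have : f t = 1 := by
      refine min_eq_left (le_max_of_le_right ?_)
      have : 2 ≤ |t| / (ε / 2) := by rw [le_div_iff₀ (by positivity)]; linarith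
      linarith
    rw [this]
    simpa using hε.le

lemma finrank_map_lt {s : H →ₗ[ℂ] H} {R : Submodule ℂ H} [FiniteDimensional ℂ R] {h : H}
    (hR : h ∈ R) (h0 : h ≠ 0) (hs : s h = 0) :
    Module.finrank ℂ (R.map s) < Module.finrank ℂ R := by
  have h1 := LinearMap.finrank_range_add_finrank_ker (s.domRestrict R)
  rw [LinearMap.range_domRestrict] at h1
  have h2 : 0 < Module.finrank ℂ (LinearMap.ker (s.domRestrict R)) := by
    rw [Module.finrank_pos_iff]
    refine nontrivial_of_ne (⟨⟨h, hR⟩, hs⟩ : LinearMap.ker (s.domRestrict R)) 0 fun h' => h0 ?_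
    exact congrArg (fun x : LinearMap.ker (s.domRestrict R) => ((x : R) : H)) h'
  omega

lemma exists_eigenvector {T : H →ₗ[ℂ] H} {R : Submodule ℂ H} [FiniteDimensional ℂ R]
    (hR : R ≠ ⊥) (hT : ∀ x ∈ R, T x ∈ R) : ∃ (z : ℂ) (h : H), h ∈ R ∧ h ≠ 0 ∧ T h = z • h := by
  have : Nontrivial R := Submodule.nontrivial_iff_ne_bot.mpr hR
  obtain ⟨z, hz⟩ := Module.End.exists_eigenvalue (T.restrict hT)
  obtain ⟨v, hv⟩ := hz.exists_hasEigenvector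
  exact ⟨z, v, v.2, fun h => hv.2 (Subtype.ext h), congrArg Subtype.val hv.apply_eq_smul⟩

/-- A nonzero element of finite rank in a right ideal `b A`, with `b` self-adjoint, yields a minimal
projection in this ideal. -/
lemma exists_isMinimalProjection_mul_ne_zero (hinj : Function.Injective φ) {b c : A}
    (hb : IsSelfAdjoint b) (hc : HasFiniteRank φ c) (hbc : b * c ≠ 0) :
    ∃ e : A, IsMinimalProjection e ∧ b * e ≠ 0 := by
  set rk : A → ℕ := fun a => Module.finrank ℂ (LinearMap.range (φ a : H →ₗ[ℂ] H)) with hrk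
  -- A nonzero `d` of least rank in `b A` is chosen; `d d*` will be a scalar multiple of the
  -- required projection.
  set S : Set A := {d | (∃ k, d = b * k) ∧ d ≠ 0 ∧ HasFiniteRank φ d} with hS
  have hne : S.Nonempty := by
    refine ⟨b * c, ⟨c, rfl⟩, hbc, ?_⟩
    have := hc
    rw [HasFiniteRank] at this
    have hr : LinearMap.range (φ (b * c) : H →ₗ[ℂ] H)
        = (LinearMap.range (φ c : H →ₗ[ℂ] H)).map (φ b : H →ₗ[ℂ] H) := by
      rw [map_mul, ← LinearMap.range_comp]; rfl
    rw [HasFiniteRank, hr]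
    infer_instance
  obtain ⟨d, ⟨⟨k, hk⟩, hd0, hdfin⟩, hmin⟩ := (InvImage.wf rk Nat.lt_wfRel.wf).has_min S hne
  have hdfin' : FiniteDimensional ℂ (LinearMap.range (φ d : H →ₗ[ℂ] H)) := hdfin
  set c := d * star d with hcdef
  have hcb : c = b * (k * star d) := by rw [hcdef, ← mul_assoc, ← hk]
  have hc0 : c ≠ 0 := fun h => hd0 (CStarRing.mul_star_self_eq_zero_iff d |>.mp h)
  have hcsa : star c = c := by simp [hcdef]
  set R := LinearMap.range (φ c : H →ₗ[ℂ] H) with hR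
  have hRle : R ≤ LinearMap.range (φ d : H →ₗ[ℂ] H) := by
    rintro _ ⟨h, rfl⟩
    refine ⟨φ (star d) h, ?_⟩
    simp [hcdef]
  have hRfin : FiniteDimensional ℂ R := Submodule.finiteDimensional_of_le hRle
  have hRrk : Module.finrank ℂ R ≤ rk d := Submodule.finrank_mono hRle
  have hRbot : R ≠ ⊥ := fun h => hc0 <| hinj <| by
    rw [map_zero]
    exact ContinuousLinearMap.coe_injective (LinearMap.range_eq_bot.mp h)
  have hmem : ∀ x, φ c x ∈ R := fun x => ⟨x, rfl⟩
  -- By minimality of the rank: an element of `b A` of the form `s ∘ φ c`, with `s` killing a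
  -- nonzero vector of the range of `φ c`, has rank below that of `d` and must vanish. Eigenvectors
  -- supply such vectors.
  have key : ∀ (q k' : A) (s : H →ₗ[ℂ] H) (h : H), q = b * k' → (∀ x, φ q x = s (φ c x)) →
      h ∈ R → h ≠ 0 → s h = 0 → q = 0 := by
    intro q k' s h hq hs hhR hh0 hsh
    by_contra hq0
    have hrange : LinearMap.range (φ q : H →ₗ[ℂ] H) = R.map s := by
      rw [hR, ← LinearMap.range_comp]
      congr 1
      ext x
      exact hs x
    have hqS : q ∈ S := by
      refine ⟨⟨k', hq⟩, hq0, ?_⟩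
      rw [HasFiniteRank, hrange]
      infer_instance
    refine hmin q hqS ?_
    change Module.finrank ℂ (LinearMap.range (φ q : H →ₗ[ℂ] H)) < rk d
    rw [hrange]
    exact (finrank_map_lt hhR hh0 hsh).trans_le hRrk
  obtain ⟨z, h, hhR, hh0, hzh⟩ := exists_eigenvector (T := (φ c : H →ₗ[ℂ] H)) hRbot
    fun x _ => hmem x
  have hcc : c * c = z • c := by
    rw [← sub_eq_zero]
    refine key _ (k * star d * c - z • (k * star d)) ((φ c : H →ₗ[ℂ] H) - z • LinearMap.id) h
      ?_ (fun x => ?_) hhR hh0 ?_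
    · rw [mul_sub, mul_smul_comm, ← mul_assoc b, ← hcb]
    · simp
    · simpa using sub_eq_zero.mpr hzh
  have hz0 : z ≠ 0 := by
    rintro rfl
    rw [zero_smul] at hcc
    refine hc0 ((CStarRing.star_mul_self_eq_zero_iff c).mp ?_)
    rwa [hcsa]
  have hzr : star z = z := by
    have h1 := congrArg star hcc
    rw [star_mul, star_smul, hcsa, hcc] at h1
    exact (smul_left_injective ℂ hc0 h1).symm
  set e := z⁻¹ • c with he
  have hee : e * e = e := by
    rw [he, smul_mul_smul_comm, hcc, smul_smul]
    congr 1
    field_simp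
  have hse : star e = e := by rw [he, star_smul, hcsa, star_inv₀, hzr]
  have he0 : e ≠ 0 := smul_ne_zero (inv_ne_zero hz0) hc0
  obtain ⟨k₂, heb⟩ : ∃ k₂, e = b * k₂ := ⟨z⁻¹ • (k * star d), by rw [he, hcb, mul_smul_comm]⟩
  have hφe : ∀ x, φ e x = z⁻¹ • φ c x := fun x => by simp [he]
  refine ⟨e, ⟨⟨hee, hse⟩, he0, fun a => ?_⟩, fun hbe => he0 ?_⟩
  -- With `m` an eigenvalue of `φ (e a)` on `R`, `key` applies to `e a e - m e = (e a - m) e`.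
  · obtain ⟨m, h', hhR', hh0', hmh⟩ := exists_eigenvector (T := (φ (e * a) : H →ₗ[ℂ] H)) hRbot
      fun x _ => by
        change φ (e * a) x ∈ R
        rw [map_mul, mul_apply_eq_comp, hφe]
        exact R.smul_mem _ (hmem _)
    refine ⟨m, ?_⟩
    rw [← sub_eq_zero]
    refine key _ (k₂ * a * e - m • k₂)
      (z⁻¹ • ((φ (e * a) : H →ₗ[ℂ] H) - m • LinearMap.id)) h' ?_ (fun x => ?_) hhR' hh0' ?_
    · rw [mul_sub, mul_smul_comm m b k₂, ← heb, ← mul_assoc, ← mul_assoc, ← heb]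
    · simp only [map_sub, map_mul, map_smul, LinearMap.smul_apply, LinearMap.sub_apply,
        LinearMap.id_apply, sub_apply, mul_apply_eq_comp, smul_apply,
        ContinuousLinearMap.coe_coe, hφe, smul_sub]
      rw [smul_comm z⁻¹ m]
    · have : φ (e * a) h' - m • h' = 0 := sub_eq_zero.mpr hmh
      simp only [LinearMap.smul_apply, LinearMap.sub_apply, LinearMap.id_apply,
        ContinuousLinearMap.coe_coe]
      rw [this, smul_zero]
  · have h1 : e * b = 0 := by
      have := congrArg star hbe
      rwa [star_mul, hse, hb.star_eq, star_zero] at this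
    calc e = e * (b * k₂) := by rw [← heb, hee]
      _ = 0 := by rw [← mul_assoc, h1, zero_mul]

variable {V : Type*}
  [NormedAddCommGroup V] [NormedSpace ℂ V] [SMul Aᵐᵒᵖ V] [CStarModule Aᵐᵒᵖ V]

lemma exists_norm_sub_act_le (hφ : ∀ a, IsCompactOperator (φ a)) (y : V) {ε : ℝ} (hε : 0 < ε) :
    ∃ a : A, IsSelfAdjoint a ∧ HasFiniteRank φ a ∧ ‖y - y <• a‖ ≤ ε := by
  obtain ⟨a, ha, hfin, h⟩ := exists_approximate_unit hφ (b := aProd A y y) (star_aProd A y y)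
    (pow_pos hε 2)
  refine ⟨a, ha, hfin, (pow_le_pow_iff_left₀ (norm_nonneg _) hε.le two_ne_zero).mp ?_⟩
  rw [norm_sq_eq_norm_aProd A]
  have heq : aProd A (y - y <• a) (y - y <• a) = aProd A y y - aProd A y y * a - a * aProd A y y
      + a * aProd A y y * a := by
    rw [aProd_sub_left, aProd_sub_right, aProd_sub_right, aProd_act_left, aProd_act_left,
      aProd_act_right, ha.star_eq, mul_assoc]
    abel
  rwa [heq]

/-- For a minimal projection `e` with `(x, x) e ≠ 0`, the square of `x · e` is `e (x, x) e = z e`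
with `z > 0`; rescaling by `1 / √z` makes it `e`. -/
lemma exists_act_isMinimalProjection (hinj : Function.Injective φ)
    (hφ : ∀ a, IsCompactOperator (φ a)) {x : V} (hx : x ≠ 0) :
    ∃ a : A, IsMinimalProjection (aProd A (x <• a) (x <• a)) := by
  have hb0 : aProd A x x ≠ 0 := fun h => hx ((aProd_self_eq_zero A).mp h)
  have hb : IsSelfAdjoint (aProd A x x) := star_aProd A x x
  -- The tolerance `‖b‖ / 2` for `b = (x, x)` excludes `b a = 0`, which would leave an error of norm
  -- `‖b‖`.
  obtain ⟨a, ha, hfin, h⟩ := exists_approximate_unit hφ hb (half_pos (norm_pos_iff.mpr hb0))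
  have hba : aProd A x x * a ≠ 0 := fun h0 => by
    have h1 : a * aProd A x x = 0 := by
      have := congrArg star h0
      rwa [star_mul, ha.star_eq, hb.star_eq, star_zero] at this
    rw [h0, h1, sub_zero, sub_zero, zero_mul, add_zero] at h
    linarith [norm_pos_iff.mpr hb0]
  obtain ⟨e, he, hbe⟩ := exists_isMinimalProjection_mul_ne_zero hinj hb hfin hba
  have hse : star e = e := he.1.isSelfAdjoint
  obtain ⟨z, hz⟩ := he.2.2 (aProd A x x)
  have hxe : aProd A (x <• e) (x <• e) = z • e := by
    rw [aProd_act_left, aProd_act_right, hse, ← mul_assoc, hz]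
  have hze : z • e ≠ 0 := fun h0 => hbe (by
    rw [h0] at hxe
    rw [← aProd_act_right, (aProd_self_eq_zero A).mp hxe, aProd_zero_right])
  have hzr : star z = z := by
    have h1 := congrArg star hxe
    rw [star_aProd, hxe, star_smul, hse] at h1
    exact (smul_left_injective ℂ he.2.1 h1).symm
  obtain ⟨r, rfl⟩ : ∃ r : ℝ, (r : ℂ) = z := Complex.conj_eq_iff_real.mp hzr |>.imp fun _ h => h.symm
  have hnonneg : 0 ≤ r • e := by
    rw [← Complex.coe_smul, ← hxe]; exact aProd_self_nonneg A _
  have hr : 0 < r := by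
    by_contra hr
    have h1 : 0 ≤ (-r) • e := smul_nonneg (by linarith) he.1.nonneg
    rw [neg_smul, neg_nonneg] at h1
    exact hze (by rw [Complex.coe_smul]; exact le_antisymm h1 hnonneg)
  refine ⟨((√r)⁻¹ : ℂ) • e, ?_⟩
  convert he using 1
  rw [act_smul, aProd_smul_left, aProd_smul_right, hxe, smul_smul, smul_smul, mul_assoc]
  have : (star ((√r)⁻¹ : ℂ)) * (((√r)⁻¹ : ℂ) * r) = 1 := by
    rw [RCLike.star_def, map_inv₀, Complex.conj_ofReal, ← mul_assoc, ← mul_inv,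
      ← Complex.ofReal_mul, Real.mul_self_sqrt hr.le]
    exact inv_mul_cancel₀ (Complex.ofReal_ne_zero.mpr hr.ne')
  rw [this, one_smul]

end CompactAlgebra

/-! ### Fredholm implies closed range and finite dimensions. -/

section Necessity

variable {A : Type*} [NonUnitalCStarAlgebra A] [PartialOrder A] [StarOrderedRing A]
variable {H : Type*} [NormedAddCommGroup H] [InnerProductSpace ℂ H] [CompleteSpace H]
  {φ : A →⋆ₙₐ[ℂ] (H →L[ℂ] H)}
variable {U V : Type*}
  [NormedAddCommGroup U] [NormedSpace ℂ U] [SMul Aᵐᵒᵖ U] [CStarModule Aᵐᵒᵖ U]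
  [NormedAddCommGroup V] [NormedSpace ℂ V] [SMul Aᵐᵒᵖ V] [CStarModule Aᵐᵒᵖ V]

lemma HasFiniteRank.of_isStarProjection (hφ : ∀ a, IsCompactOperator (φ a)) {e : A}
    (he : IsStarProjection e) : HasFiniteRank φ e := by
  have := finiteDimensional_ker_sub_one (hφ e)
  refine Submodule.finiteDimensional_of_le (S₂ := LinearMap.ker
    ((φ e - 1 : H →L[ℂ] H) : H →ₗ[ℂ] H)) ?_
  rintro _ ⟨h, rfl⟩
  have := congrArg (fun a => φ a h) he.isIdempotentElem.eq
  simp only [map_mul, mul_apply_eq_comp] at this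
  exact sub_eq_zero.mpr this

lemma exists_ne_zero_map_apply_eq (hinj : Function.Injective φ) {e : A}
    (he : IsMinimalProjection e) : ∃ h : H, h ≠ 0 ∧ φ e h = h := by
  have h0 : φ e ≠ 0 := fun h => he.2.1 (hinj (h.trans (map_zero φ).symm))
  obtain ⟨k, hk⟩ : ∃ k, φ e k ≠ 0 := by
    by_contra! h
    exact h0 (ContinuousLinearMap.ext h)
  refine ⟨φ e k, hk, ?_⟩
  rw [← mul_apply_eq_comp, ← map_mul, he.1.isIdempotentElem.eq]

/-- The `A`-submodule `∑ yᵢ aᵢ A`. -/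
def generated {ι : Type*} [Fintype ι] (y : ι → V) (a : ι → A) : Submodule ℂ V where
  carrier := {x | ∃ c : ι → A, x = ∑ i, y i <• (a i * c i)}
  add_mem' := by
    rintro _ _ ⟨c, rfl⟩ ⟨c', rfl⟩
    exact ⟨c + c', by simp only [Pi.add_apply, mul_add, act_add, Finset.sum_add_distrib]⟩
  zero_mem' := ⟨0, by simp only [Pi.zero_apply, mul_zero, act_zero, Finset.sum_const_zero]⟩
  smul_mem' := by
    rintro z _ ⟨c, rfl⟩
    exact ⟨z • c, by simp only [Pi.smul_apply, mul_smul_comm, act_smul, Finset.smul_sum]⟩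

lemma act_mem_generated {ι : Type*} [Fintype ι] {y : ι → V} {a : ι → A} {x : V}
    (hx : x ∈ generated y a) (b : A) : x <• b ∈ generated y a := by
  obtain ⟨c, rfl⟩ := hx
  exact ⟨fun i => c i * b, by simp only [sum_act, ← act_mul, mul_assoc]⟩

/-- Each `v = ∑ yᵢ aᵢ cᵢ` in `S`, with a nonzero vector `h` fixed by `φ (v, v)`, gives the tuple `φ
(aᵢ) φ (cᵢ) h` in a fixed finite dimensional space. Orthonormality makes these tuples independent.
-/
lemma card_le_of_subset_generated (hinj : Function.Injective φ) {ι : Type*} [Fintype ι]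
    {y : ι → V} {a : ι → A} (ha : ∀ i, HasFiniteRank φ (a i)) {S : Finset V}
    (hS : IsOrthonormalSystem A (S : Set V)) (hM : ∀ v ∈ S, v ∈ generated y a) :
    S.card ≤ Module.finrank ℂ (∀ i, LinearMap.range (φ (a i) : H →ₗ[ℂ] H)) := by
  have : ∀ i, FiniteDimensional ℂ (LinearMap.range (φ (a i) : H →ₗ[ℂ] H)) := ha
  choose c hc using fun v : S => hM v v.2
  choose h h0 hh using fun v : S => exists_ne_zero_map_apply_eq hinj (hS.1 v v.2)
  set w : S → ∀ i, LinearMap.range (φ (a i) : H →ₗ[ℂ] H) :=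
    fun v i => ⟨φ (a i) (φ (c v i) (h v)), _, rfl⟩ with hw
  have hlin : LinearIndependent ℂ w := by
    rw [Fintype.linearIndependent_iff]
    intro g hg v
    -- `L` sends the tuple of `u` to `φ (v, u) (h u)`, which is `h v` for `u = v` and `0` otherwise,
    -- so it isolates the coefficient at `v`.
    set L : (∀ i, LinearMap.range (φ (a i) : H →ₗ[ℂ] H)) →ₗ[ℂ] H :=
      ∑ i, (φ (aProd A (v : V) (y i)) : H →ₗ[ℂ] H) ∘ₗ (Submodule.subtype _) ∘ₗ LinearMap.proj i
      with hL
    have hLw : ∀ u : S, L (w u) = φ (aProd A (v : V) (u : V)) (h u) := fun u => by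
      conv_rhs => rw [hc u, aProd_sum_right]
      simp only [hL, hw, aProd_act_right, map_sum, map_mul, sum_apply, LinearMap.sum_apply,
        LinearMap.comp_apply, LinearMap.proj_apply, Submodule.subtype_apply,
        ContinuousLinearMap.coe_coe, mul_apply_eq_comp]
    have := congrArg L hg
    rw [map_sum, map_zero, Finset.sum_eq_single_of_mem v (Finset.mem_univ v), map_smul, hLw,
      hh] at this
    · exact (smul_eq_zero.mp this).resolve_right (h0 v)
    · intro u _ huv
      rw [map_smul, hLw, hS.2 v v.2 u u.2 fun h' => huv (Subtype.ext h'.symm)]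
      simp
  simpa using hlin.fintype_card_le_finrank

/-- An `A`-submodule of a submodule generated by finitely many elements of finite rank has a finite
orthonormal basis in the algebraic sense. -/
lemma exists_finset_finsetProj_eq (hinj : Function.Injective φ)
    (hφ : ∀ a, IsCompactOperator (φ a)) {ι : Type*} [Fintype ι]
    {y : ι → V} {a : ι → A} (ha : ∀ i, HasFiniteRank φ (a i)) {M : Submodule ℂ V}
    (hM : ∀ x ∈ M, ∀ b : A, x <• b ∈ M) (hMle : M ≤ generated y a) :
    ∃ S : Finset V, IsOrthonormalSystem A (S : Set V) ∧ (S : Set V) ⊆ M ∧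
      ∀ x ∈ M, finsetProj A S x = x := by
  classical
  set K : Set ℕ := {n | ∃ S : Finset V, IsOrthonormalSystem A (S : Set V) ∧ (S : Set V) ⊆ M ∧
    S.card = n} with hK
  have hne : K.Nonempty := ⟨0, ∅, ⟨by simp, by simp⟩, by simp, rfl⟩
  have hbdd : BddAbove K := by
    refine ⟨Module.finrank ℂ (∀ i, LinearMap.range (φ (a i) : H →ₗ[ℂ] H)), ?_⟩
    rintro _ ⟨S, hS, hSM, rfl⟩
    exact card_le_of_subset_generated hinj ha hS fun v hv => hMle (hSM hv)
  obtain ⟨S, hS, hSM, hcard⟩ := Nat.sSup_mem hne hbdd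
  -- If the projection missed part of `x`, the remainder, orthogonal to `S`, would have a multiple
  -- enlarging the maximal system.
  refine ⟨S, hS, hSM, fun x hx => ?_⟩
  by_contra hne'
  have hz0 : x - finsetProj A S x ≠ 0 := fun h => hne' (sub_eq_zero.mp h).symm
  have hzM : x - finsetProj A S x ∈ M := by
    rw [finsetProj_apply]
    exact M.sub_mem hx (M.sum_mem fun v hv => hM v (hSM hv) _)
  have hzS : ∀ v ∈ S, aProd A v (x - finsetProj A S x) = 0 := fun v hv => by
    rw [aProd_sub_right, ← isAdjoint_finsetProj S, hS.finsetProj_apply_self hv, sub_self]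
  obtain ⟨b, hb⟩ := exists_act_isMinimalProjection hinj hφ hz0
  set t := (x - finsetProj A S x) <• b with ht
  have htS : ∀ v ∈ S, aProd A v t = 0 := fun v hv => by
    rw [ht, aProd_act_right, hzS v hv, zero_mul]
  have htnot : t ∉ S := fun h => hb.2.1 (htS t h)
  have hmem : S.card + 1 ∈ K := by
    refine ⟨insert t S, ⟨?_, ?_⟩, ?_, Finset.card_insert_of_notMem htnot⟩
    · intro v hv
      rcases Finset.mem_insert.mp hv with rfl | hv
      · exact hb
      · exact hS.1 v hv
    · intro v hv u hu hvu
      rcases Finset.mem_insert.mp hv with rfl | hv <;> rcases Finset.mem_insert.mp hu with rfl | hu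
      · exact absurd rfl hvu
      · rw [← star_aProd, htS u hu, star_zero]
      · exact htS v hv
      · exact hS.2 v hv u hu hvu
    · intro v hv
      rcases Finset.mem_insert.mp hv with rfl | hv
      · exact hM _ hzM b
      · exact hSM hv
  have := le_csSup hbdd hmem
  omega

lemma dimA_lt_top_of_le_generated (hinj : Function.Injective φ)
    (hφ : ∀ a, IsCompactOperator (φ a)) {ι : Type*} [Fintype ι]
    {y : ι → V} {a : ι → A} (ha : ∀ i, HasFiniteRank φ (a i)) {M : Submodule ℂ V}
    (hcl : IsClosed (M : Set V)) (hM : ∀ x ∈ M, ∀ b : A, x <• b ∈ M)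
    (hMle : M ≤ generated y a) : dimA A M < ⊤ := by
  obtain ⟨S, hS, hSM, hproj⟩ := exists_finset_finsetProj_eq hinj hφ ha hM hMle
  refine (iInf₂_le (S : Set V) ⟨hS, ?_⟩).trans_lt ((Finset.finite_toSet S).encard_lt_top)
  refine subset_antisymm (closure_minimal ?_ hcl) fun x hx => subset_closure ?_
  · refine Submodule.span_le.mpr ?_
    rintro _ (hv | ⟨v, hv, b, rfl⟩)
    · exact hSM hv
    · exact hM v (hSM hv) b
  · rw [← hproj x hx, finsetProj_apply]
    exact Submodule.sum_mem _ fun v hv => Submodule.subset_span (Or.inr ⟨v, hv, _, rfl⟩)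

/-- An `A`-compact operator is a finite sum of elementary operators with finite rank coefficients
up to an operator of norm less than one. -/
lemma IsACompact.exists_norm_sub_lt_one (hφ : ∀ a, IsCompactOperator (φ a)) {P : U →L[ℂ] V}
    (hP : IsACompact A P) : ∃ (n : ℕ) (y : Fin n → V) (a : Fin n → A) (x : Fin n → U),
      (∀ i, IsSelfAdjoint (a i)) ∧ (∀ i, HasFiniteRank φ (a i)) ∧
      ‖P - ∑ i, rankOne A (y i <• a i) (x i)‖ < 1 := by
  set N : Submodule ℂ (U →L[ℂ] V) := Submodule.span ℂ
    {T | ∃ (y : V) (a : A) (x : U), IsSelfAdjoint a ∧ HasFiniteRank φ a ∧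
      T = rankOne A (y <• a) x} with hN
  have hle : finiteRank A U V ≤ N.topologicalClosure := by
    refine Submodule.span_le.mpr ?_
    rintro T ⟨u, v, hT⟩
    obtain rfl : T = rankOne A v u := ContinuousLinearMap.ext hT
    refine Metric.mem_closure_iff.mpr fun ε hε => ?_
    obtain ⟨a, ha, hfin, h⟩ := exists_norm_sub_act_le hφ v
      (show 0 < ε / (2 * (‖u‖ + 1)) by positivity)
    refine ⟨rankOne A (v <• a) u, Submodule.subset_span ⟨v, a, u, ha, hfin, rfl⟩, ?_⟩
    rw [dist_eq_norm, ← rankOne_sub_left]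
    calc _ ≤ ‖v - v <• a‖ * ‖u‖ := norm_rankOne_le A _ _
      _ ≤ ε / (2 * (‖u‖ + 1)) * (‖u‖ + 1) := by gcongr; linarith
      _ = ε / 2 := by field_simp
      _ < ε := half_lt_self hε
  have hPN : P ∈ closure (N : Set (U →L[ℂ] V)) :=
    closure_minimal hle N.isClosed_topologicalClosure hP.2
  obtain ⟨R, hR, hdist⟩ := Metric.mem_closure_iff.mp hPN 1 one_pos
  obtain ⟨n, z, g, rfl⟩ := Submodule.mem_span_set'.mp hR
  choose y a x ha hfin hg using fun i => (g i).2
  refine ⟨n, fun i => z i • y i, a, x, ha, hfin, ?_⟩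
  rw [dist_eq_norm] at hdist
  have heq : ∑ i, rankOne A ((z i • y i) <• a i) (x i) = ∑ i, z i • (g i : U →L[ℂ] V) :=
    Finset.sum_congr rfl fun i _ => by
      rw [hg]
      ext u
      simp only [rankOne_apply, smul_act, smul_apply]
  rwa [heq]

lemma IsALinear.exists_inverse_one_add [CompleteSpace U] {S : U →L[ℂ] U} (hS : IsALinear A S)
    (hnorm : ‖S‖ < 1) : ∃ T : U →L[ℂ] U, IsALinear A T ∧ ∀ x, T (x + S x) = x := by
  obtain ⟨u, hu⟩ := isUnit_one_sub_of_norm_lt_one (x := -S) (by rwa [norm_neg])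
  have hux : ∀ x, (u : U →L[ℂ] U) x = x + S x := fun x => by simp [hu]
  have h1 : ∀ x, (↑u⁻¹ : U →L[ℂ] U) (x + S x) = x := fun x => by
    rw [← hux, ← mul_apply_eq_comp, Units.inv_mul, one_apply_eq_self]
  have h2 : ∀ x, (↑u⁻¹ : U →L[ℂ] U) x + S ((↑u⁻¹ : U →L[ℂ] U) x) = x := fun x => by
    rw [← hux, ← mul_apply_eq_comp, Units.mul_inv, one_apply_eq_self]
  refine ⟨↑u⁻¹, fun x a => ?_, h1⟩
  conv_lhs => rw [← h2 x, add_act, ← hS, h1]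

/-- Applying `T = (1 + S)⁻¹` gives `m = -∑ T(yᵢ) aᵢ (xᵢ, m)`; by `A`-linearity of `T` the finite
rank factors `aᵢ` survive. -/
lemma le_generated_of_add_eq_zero [CompleteSpace U] {S : U →L[ℂ] U} (hS : IsALinear A S)
    (hnorm : ‖S‖ < 1) {ι : Type*} [Fintype ι] (y x : ι → U) (a : ι → A) {M : Submodule ℂ U}
    (h : ∀ m ∈ M, m + S m + ∑ i, (y i <• a i) <• aProd A (x i) m = 0) :
    ∃ y' : ι → U, M ≤ generated y' a := by
  obtain ⟨T, hT, hTS⟩ := hS.exists_inverse_one_add hnorm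
  refine ⟨fun i => -T (y i), fun m hm => ⟨fun i => aProd A (x i) m, ?_⟩⟩
  have h1 := congrArg T (eq_neg_of_add_eq_zero_left (h m hm))
  rw [hTS] at h1
  conv_lhs => rw [h1]
  simp only [map_neg, map_sum, hT _ _, neg_act, Finset.sum_neg_distrib, act_mul]

/-- `G F` is the identity on the orthogonal complement of a finite orthonormal system `S`, so `1 - F
G` maps `Im F` into the submodule generated by its values on the finitely many `F v`, `v ∈ S`. That
submodule lies in `Im F` and is the fixed set of a finite projection. -/
lemma isClosed_range_of_left_inverse (hinj : Function.Injective φ)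
    (hφ : ∀ a, IsCompactOperator (φ a)) {F : U →L[ℂ] V} (hF : IsALinear A F) {G : V →L[ℂ] U}
    (hG : IsALinear A G) {ι : Type*} [Fintype ι] (y x : ι → U) (a : ι → A)
    (ha : ∀ i, IsSelfAdjoint (a i)) (hfin : ∀ i, HasFiniteRank φ (a i))
    (h : ∀ u, G (F u) = u + ∑ i, (y i <• a i) <• aProd A (x i) u) : IsClosed (Set.range F) := by
  classical
  obtain ⟨S, hS, hSM, hproj⟩ := exists_finset_finsetProj_eq hinj hφ hfin
    (fun u hu => act_mem_generated hu) (le_refl (generated x a))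
  have hfix : ∀ i, finsetProj A S (x i <• a i) = x i <• a i := fun i => by
    rw [← sub_eq_zero]
    -- Without a unit, `xᵢ aᵢ` need not lie in `∑ xᵢ aᵢ A`, but all its multiples do. So the
    -- difference `d` satisfies `d · b = 0` for every `b`, and `b = (d, d)*` forces `d = 0`.
    refine (aProd_self_eq_zero A).mp ((CStarRing.mul_star_self_eq_zero_iff _).mp ?_)
    have h1 : ∀ b : A, (finsetProj A S (x i <• a i) - x i <• a i) <• b = 0 := fun b => by
      rw [sub_act, ← (isAdjoint_finsetProj S).isALinear, hproj, sub_self]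
      refine ⟨Pi.single i b, ?_⟩
      rw [Finset.sum_eq_single_of_mem i (Finset.mem_univ i), Pi.single_eq_same, act_mul]
      intro j _ hj
      rw [Pi.single_eq_of_ne hj, mul_zero, act_zero]
    rw [← aProd_act_right, h1, aProd_zero_right]
  have hGF : ∀ u, G (F (u - finsetProj A S u)) = u - finsetProj A S u := fun u => by
    rw [h, add_eq_left]
    refine Finset.sum_eq_zero fun i _ => ?_
    have h1 : (y i <• a i) <• aProd A (x i) (u - finsetProj A S u)
        = y i <• aProd A (x i <• a i) (u - finsetProj A S u) := by
      rw [aProd_act_left, (ha i).star_eq, act_mul]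
    rw [h1, aProd_sub_right, ← isAdjoint_finsetProj S, hfix, sub_self, act_zero]
  set z : S → V := fun v => F v - F (G (F v)) with hz
  set e : S → A := fun v => aProd A (v : U) (v : U) with he
  obtain ⟨T, hT, hTM, hTproj⟩ := exists_finset_finsetProj_eq hinj hφ (y := z) (a := e)
    (fun v => HasFiniteRank.of_isStarProjection hφ (hS.1 v v.2).1)
    (fun u hu => act_mem_generated hu) (le_refl (generated z e))
  have hrange : Set.range F = {v | finsetProj A T (v - F (G v)) = v - F (G v)} := by
    refine subset_antisymm ?_ fun v hv => ?_
    · rintro _ ⟨u, rfl⟩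
      refine hTproj _ ⟨fun v => aProd A (v : U) u, ?_⟩
      have h1 := congrArg F (hGF u)
      rw [map_sub, map_sub, map_sub, sub_eq_sub_iff_sub_eq_sub] at h1
      have h2 : F u - F (G (F u)) = F (finsetProj A S u) - F (G (F (finsetProj A S u))) := by
        rw [← neg_sub, h1, neg_sub]
      rw [h2, finsetProj_apply]
      simp only [map_sum, hF _ _, hG _ _]
      rw [← Finset.sum_sub_distrib, ← Finset.sum_coe_sort S]
      refine Finset.sum_congr rfl fun v _ => ?_
      have h3 : e v * aProd A (v : U) u = aProd A (v : U) u := by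
        conv_rhs => rw [← act_aProd_self_of_isStarProjection A (hS.1 v v.2).1, aProd_act_left,
          star_aProd]
      rw [← sub_act, h3]
    · have hgen : ∀ t ∈ generated z e, t ∈ LinearMap.range (F : U →ₗ[ℂ] V) := by
        rintro _ ⟨c, rfl⟩
        refine Submodule.sum_mem _ fun w _ => ⟨((w : U) - G (F w)) <• (e w * c w), ?_⟩
        change F _ = _
        rw [hF, map_sub]
      have h1 : v - F (G v) ∈ LinearMap.range (F : U →ₗ[ℂ] V) := by
        refine hgen _ ?_
        rw [← show finsetProj A T (v - F (G v)) = v - F (G v) from hv, finsetProj_apply]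
        exact Submodule.sum_mem _ fun t ht => act_mem_generated (hTM ht) _
      have h2 : F (G v) ∈ LinearMap.range (F : U →ₗ[ℂ] V) := ⟨G v, rfl⟩
      have h3 := Submodule.add_mem _ h1 h2
      rwa [sub_add_cancel] at h3
  rw [hrange]
  exact isClosed_eq (by fun_prop) (by fun_prop)

lemma isClosed_orthogonalComplement (W : Set V) :
    IsClosed (orthogonalComplement A W : Set V) := by
  have : (orthogonalComplement A W : Set V) = ⋂ w ∈ W, {v | aProd A v w = 0} := by
    ext v; simp [orthogonalComplement]
  rw [this]
  exact isClosed_biInter fun w _ => isClosed_eq (continuous_aProd_left A w) continuous_const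

theorem IsAFredholm.isClosed_range_and_dimA_lt_top (hinj : Function.Injective φ)
    (hφ : ∀ a, IsCompactOperator (φ a)) [CompleteSpace U] [CompleteSpace V] {F : U →L[ℂ] V}
    (hFred : IsAFredholm A F) : IsClosed (Set.range F) ∧
      dimA A (LinearMap.ker (F : U →ₗ[ℂ] V)) < ⊤ ∧
      dimA A (orthogonalComplement A (Set.range F)) < ⊤ := by
  obtain ⟨hF, ⟨G, P, hG, hP, hGF⟩, ⟨G', P', hG', hP', hFG⟩⟩ := hFred
  obtain ⟨n, y, a, x, ha, hfin, hnorm⟩ := hP.exists_norm_sub_lt_one hφ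
  obtain ⟨n', y', a', x', ha', hfin', hnorm'⟩ := hP'.exists_norm_sub_lt_one hφ
  have hS : IsALinear A (P - ∑ i, rankOne A (y i <• a i) (x i)) :=
    IsALinear.sub hP.1.1
      (IsAdjoint.sum _ fun i _ => isAdjoint_rankOne (y i <• a i) (x i)).isALinear
  have hGFx : ∀ u, G (F u) = u + (P - ∑ i, rankOne A (y i <• a i) (x i)) u
      + ∑ i, (y i <• a i) <• aProd A (x i) u := fun u => by
    have := congrArg (fun T : U →L[ℂ] U => T u) hGF
    simp only [ContinuousLinearMap.comp_apply, add_apply, ContinuousLinearMap.id_apply] at this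
    rw [this]
    simp [rankOne_apply, add_assoc]
  refine ⟨?_, ?_, ?_⟩
  · obtain ⟨T, hT, hTS⟩ := hS.exists_inverse_one_add hnorm
    refine isClosed_range_of_left_inverse hinj hφ hF.1 (hT.comp hG.1) (fun i => T (y i)) x a ha
      hfin fun u => ?_
    rw [ContinuousLinearMap.comp_apply, hGFx, map_add, hTS, map_sum]
    simp only [hT _ _]
  · obtain ⟨z, hz⟩ := le_generated_of_add_eq_zero hS hnorm y x a
      (M := LinearMap.ker (F : U →ₗ[ℂ] V)) fun m hm => by
        rw [← hGFx, show F m = 0 from hm, map_zero]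
    refine dimA_lt_top_of_le_generated hinj hφ hfin F.isClosed_ker (fun u hu b => ?_) hz
    change F _ = 0
    rw [hF.1, show F u = 0 from hu, zero_act]
  -- For `m` orthogonal to `Im F`, `(w, m + P'' m) = (F (G' w), m) = 0` for all `w`. The adjoint of
  -- the approximating sum is again of the required form, with `x'` and `y'` exchanged, because the
  -- `a'ᵢ` are self-adjoint.
  · obtain ⟨P'', hPadj⟩ := hP'.1.exists_isAdjoint
    have hadj : IsAdjoint A (P' - ∑ i, rankOne A (y' i <• a' i) (x' i))
        (P'' - ∑ i, rankOne A (x' i) (y' i <• a' i)) :=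
      hPadj.sub (IsAdjoint.sum _ fun i _ => isAdjoint_rankOne (y' i <• a' i) (x' i))
    obtain ⟨z, hz⟩ := le_generated_of_add_eq_zero hadj.symm.isALinear
      (hadj.norm_le.trans_lt hnorm') x' y' a' (M := orthogonalComplement A (Set.range F))
      fun m hm => by
        have h1 : m + (P'' - ∑ i, rankOne A (x' i) (y' i <• a' i)) m
            + ∑ i, (x' i <• a' i) <• aProd A (y' i) m = m + P'' m := by
          have h2 : ∀ i, rankOne A (x' i) (y' i <• a' i) m = (x' i <• a' i) <• aProd A (y' i) m :=
            fun i => by rw [rankOne_apply, aProd_act_left, (ha' i).star_eq, act_mul]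
          simp only [sub_apply, sum_apply, h2]
          abel
        rw [h1]
        refine eq_of_aProd_right A fun w => ?_
        have h3 := congrArg (fun T : V →L[ℂ] V => T w) hFG
        simp only [ContinuousLinearMap.comp_apply, add_apply, ContinuousLinearMap.id_apply] at h3
        rw [aProd_add_right, ← hPadj, ← aProd_add_left, ← h3, ← star_aProd, hm _ ⟨_, rfl⟩,
          star_zero, aProd_zero_right]
    refine dimA_lt_top_of_le_generated hinj hφ hfin' (isClosed_orthogonalComplement _)
      (fun u hu b => ?_) hz
    intro w hw
    rw [aProd_act_left, hu w hw, mul_zero]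

end Necessity

end HilbertCStar

theorem corollary5
    (A : Type*) [NonUnitalCStarAlgebra A] [PartialOrder A] [StarOrderedRing A]
    (hA : HilbertCStar.IsAlgebraOfCompactOperators.{w} A)
    (U : Type*) [NormedAddCommGroup U] [NormedSpace ℂ U] [CompleteSpace U]
    [SMul Aᵐᵒᵖ U] [CStarModule Aᵐᵒᵖ U]
    (V : Type*) [NormedAddCommGroup V] [NormedSpace ℂ V] [CompleteSpace V]
    [SMul Aᵐᵒᵖ V] [CStarModule Aᵐᵒᵖ V]
    (F : U →L[ℂ] V) (hF : HilbertCStar.IsMorphism A F) :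
    HilbertCStar.IsAFredholm A F ↔
      IsClosed (Set.range F) ∧
      HilbertCStar.dimA A (LinearMap.ker (F : U →ₗ[ℂ] V)) < ⊤ ∧
      HilbertCStar.dimA A (HilbertCStar.orthogonalComplement A (Set.range F)) < ⊤ := by
  obtain ⟨H, _, _, _, φ, hinj, hφ⟩ := hA
  exact ⟨fun h => h.isClosed_range_and_dimA_lt_top hinj hφ,
    fun ⟨h₁, h₂, h₃⟩ => HilbertCStar.isAFredholm_of_isClosed_range hF h₁ h₂ h₃⟩
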